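/- For a permutation $\sigma$ of $\{1,\dots,d\}$ and $\mathbf a=(a_1,\dots,a_d)\in\mathbb R^d_+$ (all entries positive), let $\mathcal{IE}_\sigma(\mathbf a)\colon I\to I$, $I=[0,\sum_i a_i)$, be the interval exchange transformation that cuts $I$ into consecutive half-open intervals of lengths $a_1,\dots,a_d$ and rearranges them by translations according to $\sigma$, the $i$-th interval going to position $\sigma(i)$. It is called \emph{uniquely ergodic} if its only finite invariant Borel measure, up to scaling, is Lebesgue measure on $I$; \emph{periodic} if some positive iterate of it is the identity of $I$; and \emph{self-similar} if there are $c\in(0,1)$ and a proper subinterval $J=[u,u+c|I|)\subsetneq I$ such that the first return map of $\mathcal{IE}_\sigma(\mathbf a)$ to $J$ is, after translating $J$ to $[0,c|I|)$, equal to $\mathcal{IE}_\sigma(c\,\mathbf a)$. Then there exist $d\ge 1$, a permutation $\sigma$ of $\{1,\dots,d\}$, a nondegenerate closed line segment $\ell\subset\mathbb R^d_+$ and a point $\mathbf a_0$ in the (relative) interior of $\ell$ such that $\mathcal{IE}_\sigma(\mathbf a_0)$ is uniquely ergodic and self-similar, and $\mathcal{IE}_\sigma(\mathbf a)$ is periodic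 for every $\mathbf a\in\ell\smallsetminus\{\mathbf a_0\}$. -/

import Mathlib

open MeasureTheory

noncomputable section

namespace IntervalExchange

variable {d : ℕ}

/-- The total length `|a| = ∑ aᵢ`. -/
def total (a : Fin d → ℝ) : ℝ := ∑ i, a i

/-- The base interval `I = [0, ∑ aᵢ)`. -/
def base (a : Fin d → ℝ) : Set ℝ := Set.Ico 0 (total a)

/-- Left endpoint of the `i`-th interval of the partition of `I` into consecutive intervals of
lengths `a₁, …, a_d`. -/
def leftEnd (a : Fin d → ℝ) (i : Fin d) : ℝ := ∑ j with j < i, a j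

/-- The `i`-th interval of that partition. -/
def piece (a : Fin d → ℝ) (i : Fin d) : Set ℝ := Set.Ico (leftEnd a i) (leftEnd a i + a i)

/-- Left endpoint of the `i`-th interval after the intervals have been permuted by `σ`:
the `i`-th interval is moved to position `σ i`, so exactly the intervals `j` with `σ j < σ i`
lie to the left of it. -/
def newLeftEnd (σ : Equiv.Perm (Fin d)) (a : Fin d → ℝ) (i : Fin d) : ℝ := ∑ j with σ j < σ i, a j

/-- The interval exchange transformation `IE_σ(a)`: on the `i`-th interval it is the translation
carrying that interval to its new position. It is extended by the identity outside `I`. -/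
def IE (σ : Equiv.Perm (Fin d)) (a : Fin d → ℝ) (x : ℝ) : ℝ :=
  x + ∑ i, (piece a i).indicator (fun _ => newLeftEnd σ a i - leftEnd a i) x

/-- `IE_σ(a)` is uniquely ergodic: among the finite Borel measures carried by `I`, the invariant
ones are exactly the multiples of Lebesgue measure on `I`. -/
def UniquelyErgodic (σ : Equiv.Perm (Fin d)) (a : Fin d → ℝ) : Prop :=
  ∀ μ : Measure ℝ, IsFiniteMeasure μ → μ (base a)ᶜ = 0 →
    (MeasurePreserving (IE σ a) μ μ ↔ ∃ c : NNReal, μ = c • volume.restrict (base a))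

/-- `IE_σ(a)` is periodic: some positive iterate of it is the identity of `I`. -/
def Periodic (σ : Equiv.Perm (Fin d)) (a : Fin d → ℝ) : Prop :=
  ∃ n : ℕ, 0 < n ∧ ∀ x ∈ base a, (IE σ a)^[n] x = x

/-- `y` is the image of `x` under the first return map of `T` to `J`. -/
def IsFirstReturn (T : ℝ → ℝ) (J : Set ℝ) (x y : ℝ) : Prop :=
  ∃ n : ℕ, 0 < n ∧ T^[n] x = y ∧ y ∈ J ∧ ∀ k : ℕ, 0 < k → k < n → T^[k] x ∉ J

/-- `IE_σ(a)` is self-similar: for some `0 < c < 1` there is a proper subinterval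
`J = [u, u + c|I|)` of `I` such that the first return map to `J` is, after translating `J` to
`[0, c|I|)`, the interval exchange `IE_σ(c a)`. -/
def SelfSimilar (σ : Equiv.Perm (Fin d)) (a : Fin d → ℝ) : Prop :=
  ∃ c u : ℝ, 0 < c ∧ c < 1 ∧
    Set.Ico u (u + c * total a) ⊂ base a ∧
    ∀ x ∈ Set.Ico u (u + c * total a),
      IsFirstReturn (IE σ a) (Set.Ico u (u + c * total a)) x (u + IE σ (c • a) (x - u))

end IntervalExchange

end

/-! Let `l` be the tribonacci constant. A suitable exchange of seven intervals is deformed by a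
parameter `e`: the lengths are affine in `e`, while all translations stay fixed. For `|e| ≤ l⁻²` the
first return map to a fixed subinterval is the same exchange with parameter `l² e`, scaled by `l⁻²`
(`renormalises`, `lengths'_eq`). Renormalisation thus expands the parameter line about `e = 0`, and
this fixed point is the self-similar exchange.

If `0 < |e| ≤ 1`, finitely many renormalisations bring `|e|` into `[l⁻², 1]`. There, explicit towers
of periodic intervals fill the base (`periodic_of_scale_le`), and periodicity lifts back from an
induced map because its towers fill the original interval (`Renormalises.periodic`).

At `e = 0`, the masses that an invariant measure and its rescaled restrictions give to the exchanged
intervals form a nonnegative backward orbit of a primitive incidence matrix. Perron contraction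
(`proportional_of_backward_orbit`) makes them proportional to the lengths. Applied at every scale,
this makes the distribution function linear up to an error `O(cⁿ)` for all `n`
(`Renormalises.discrepancy_le`), so the measure is a multiple of Lebesgue measure. -/

namespace IntervalExchange

/-! ### Interval exchanges and distribution functions of invariant measures -/

section General

variable {d : ℕ}

/-- Sum of the first `n` lengths. -/
noncomputable def partialSum (a : Fin d → ℝ) (n : ℕ) : ℝ := ∑ j : Fin d with j.val < n, a j

lemma partialSum_zero (a : Fin d → ℝ) : partialSum a 0 = 0 := by
  simp [partialSum]

lemma partialSum_self (a : Fin d → ℝ) : partialSum a d = total a := by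
  simp [partialSum, total]

lemma leftEnd_eq_partialSum (a : Fin d → ℝ) (i : Fin d) : leftEnd a i = partialSum a i := by
  simp only [leftEnd, partialSum, Fin.lt_def]

lemma partialSum_succ (a : Fin d → ℝ) (i : Fin d) :
    partialSum a (i + 1) = leftEnd a i + a i := by
  have h : (Finset.univ.filter fun j : Fin d => j.val < i + 1) =
      insert i (Finset.univ.filter fun j : Fin d => j < i) := by
    ext j
    simp only [Finset.mem_filter, Finset.mem_univ, true_and, Finset.mem_insert, Fin.ext_iff,
      Fin.lt_def]
    omega
  rw [partialSum, h, Finset.sum_insert (by simp), leftEnd, add_comm]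

lemma partialSum_mono {a : Fin d → ℝ} (ha : ∀ i, 0 ≤ a i) : Monotone (partialSum a) := by
  intro m n hmn
  refine Finset.sum_le_sum_of_subset_of_nonneg ?_ fun i _ _ => ha i
  intro j
  simp only [Finset.mem_filter, Finset.mem_univ, true_and]
  omega

lemma leftEnd_nonneg {a : Fin d → ℝ} (ha : ∀ i, 0 ≤ a i) (i : Fin d) : 0 ≤ leftEnd a i :=
  Finset.sum_nonneg fun j _ => ha j

lemma rightEnd_le_leftEnd {a : Fin d → ℝ} (ha : ∀ i, 0 ≤ a i) {i j : Fin d} (hij : i < j) :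
    leftEnd a i + a i ≤ leftEnd a j := by
  rw [← partialSum_succ, leftEnd_eq_partialSum]
  exact partialSum_mono ha hij

lemma rightEnd_le_total {a : Fin d → ℝ} (ha : ∀ i, 0 ≤ a i) (i : Fin d) :
    leftEnd a i + a i ≤ total a := by
  rw [← partialSum_succ, ← partialSum_self]
  exact partialSum_mono ha i.2

lemma piece_subset_base {a : Fin d → ℝ} (ha : ∀ i, 0 ≤ a i) (i : Fin d) : piece a i ⊆ base a :=
  Set.Ico_subset_Ico (leftEnd_nonneg ha i) (rightEnd_le_total ha i)

lemma piece_disjoint {a : Fin d → ℝ} (ha : ∀ i, 0 ≤ a i) :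
    Pairwise (Function.onFun Disjoint (piece a)) := by
  intro i j hij
  rw [Function.onFun, Set.disjoint_left]
  intro x hi hj
  rcases lt_or_gt_of_ne hij with h | h
  · exact absurd (rightEnd_le_leftEnd ha h) (not_le.2 (hj.1.trans_lt hi.2))
  · exact absurd (rightEnd_le_leftEnd ha h) (not_le.2 (hi.1.trans_lt hj.2))

lemma exists_mem_piece {a : Fin d → ℝ} {x : ℝ} (hx : x ∈ base a) : ∃ i, x ∈ piece a i := by
  by_contra! h
  have key : ∀ n ≤ d, partialSum a n ≤ x := by
    intro n
    induction n with
    | zero => intro _; rw [partialSum_zero]; exact hx.1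
    | succ n ih =>
      intro hn
      by_contra! hlt
      refine h ⟨n, hn⟩ ⟨?_, ?_⟩
      · rw [leftEnd_eq_partialSum]; exact ih (by omega)
      · rw [← partialSum_succ]; exact hlt
  have := key d le_rfl
  rw [partialSum_self] at this
  exact absurd hx.2 (not_lt.2 this)

lemma iUnion_piece {a : Fin d → ℝ} (ha : ∀ i, 0 ≤ a i) : ⋃ i, piece a i = base a := by
  ext x
  exact ⟨fun h => by obtain ⟨i, hi⟩ := Set.mem_iUnion.1 h; exact piece_subset_base ha i hi,
    fun h => Set.mem_iUnion.2 (exists_mem_piece h)⟩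

/-- The translation vector of the `i`-th interval. -/
noncomputable def displacement (σ : Equiv.Perm (Fin d)) (a : Fin d → ℝ) (i : Fin d) : ℝ :=
  newLeftEnd σ a i - leftEnd a i

lemma IE_of_mem_piece (σ : Equiv.Perm (Fin d)) {a : Fin d → ℝ} (ha : ∀ i, 0 ≤ a i) {i : Fin d}
    {x : ℝ} (hx : x ∈ piece a i) : IE σ a x = x + displacement σ a i := by
  rw [IE, Finset.sum_eq_single i]
  · rw [Set.indicator_of_mem hx, displacement]
  · intro j _ hji
    exact Set.indicator_of_notMem
      (fun hj => Set.disjoint_left.1 (piece_disjoint ha hji) hj hx) _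
  · simp

lemma IE_of_notMem_base (σ : Equiv.Perm (Fin d)) {a : Fin d → ℝ} (ha : ∀ i, 0 ≤ a i) {x : ℝ}
    (hx : x ∉ base a) : IE σ a x = x := by
  rw [IE, Finset.sum_eq_zero, add_zero]
  intro j _
  exact Set.indicator_of_notMem (fun hj => hx (piece_subset_base ha j hj)) _

/-- The images of the intervals are themselves a consecutive partition, with lengths `a ∘ σ.symm`.
Disjointness and covering on the image side therefore reduce to the same facts for `piece`. -/
lemma newLeftEnd_eq (σ : Equiv.Perm (Fin d)) (a : Fin d → ℝ) (i : Fin d) :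
    newLeftEnd σ a i = leftEnd (a ∘ σ.symm) (σ i) := by
  simp only [newLeftEnd, leftEnd, Finset.sum_filter]
  rw [← Equiv.sum_comp σ (fun x => if x < σ i then (a ∘ σ.symm) x else 0)]
  simp

lemma total_comp_symm (σ : Equiv.Perm (Fin d)) (a : Fin d → ℝ) :
    total (a ∘ σ.symm) = total a :=
  Equiv.sum_comp σ.symm a

lemma add_displacement_mem_iff (σ : Equiv.Perm (Fin d)) (a : Fin d → ℝ) (i : Fin d) (x : ℝ) :
    x + displacement σ a i ∈ piece (a ∘ σ.symm) (σ i) ↔ x ∈ piece a i := by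
  simp only [displacement, newLeftEnd_eq, piece, Set.mem_Ico, Function.comp,
    Equiv.symm_apply_apply]
  constructor <;> rintro ⟨h1, h2⟩ <;> constructor <;> linarith

lemma IE_mem_newPiece (σ : Equiv.Perm (Fin d)) {a : Fin d → ℝ} (ha : ∀ i, 0 ≤ a i) {i : Fin d}
    {x : ℝ} (hx : x ∈ piece a i) : IE σ a x ∈ piece (a ∘ σ.symm) (σ i) := by
  rw [IE_of_mem_piece σ ha hx, add_displacement_mem_iff]
  exact hx

lemma IE_mem_base (σ : Equiv.Perm (Fin d)) {a : Fin d → ℝ} (ha : ∀ i, 0 ≤ a i) {x : ℝ}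
    (hx : x ∈ base a) : IE σ a x ∈ base a := by
  obtain ⟨i, hi⟩ := exists_mem_piece hx
  have h := piece_subset_base (a := a ∘ σ.symm) (fun i => ha _) _ (IE_mem_newPiece σ ha hi)
  rwa [base, total_comp_symm] at h

lemma IE_injective (σ : Equiv.Perm (Fin d)) {a : Fin d → ℝ} (ha : ∀ i, 0 ≤ a i) :
    Function.Injective (IE σ a) := by
  intro x y hxy
  by_cases hx : x ∈ base a <;> by_cases hy : y ∈ base a
  · obtain ⟨i, hi⟩ := exists_mem_piece hx
    obtain ⟨j, hj⟩ := exists_mem_piece hy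
    have h1 := IE_mem_newPiece σ ha hi
    have h2 := IE_mem_newPiece σ ha hj
    rw [hxy] at h1
    have hij : i = j := by
      by_contra hne
      exact Set.disjoint_left.1 (piece_disjoint (a := a ∘ σ.symm) (fun i => ha _)
        (fun h => hne (σ.injective h))) h1 h2
    subst hij
    rw [IE_of_mem_piece σ ha hi, IE_of_mem_piece σ ha hj] at hxy
    linarith
  · have h := IE_mem_base σ ha hx
    rw [hxy, IE_of_notMem_base σ ha hy] at h
    exact absurd h hy
  · have h := IE_mem_base σ ha hy
    rw [← hxy, IE_of_notMem_base σ ha hx] at h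
    exact absurd h hx
  · rwa [IE_of_notMem_base σ ha hx, IE_of_notMem_base σ ha hy] at hxy

lemma measurable_IE (σ : Equiv.Perm (Fin d)) (a : Fin d → ℝ) : Measurable (IE σ a) :=
  measurable_id.add (Finset.measurable_sum _ fun _ _ => measurable_const.indicator measurableSet_Ico)

lemma measurableSet_piece (a : Fin d → ℝ) (i : Fin d) : MeasurableSet (piece a i) :=
  measurableSet_Ico

lemma volume_inter_base {a : Fin d → ℝ} (ha : ∀ i, 0 ≤ a i) {s : Set ℝ} (hs : MeasurableSet s) :
    volume (s ∩ base a) = ∑ i, volume (s ∩ piece a i) := by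
  rw [← iUnion_piece ha, Set.inter_iUnion, measure_iUnion _ fun i => hs.inter (measurableSet_piece a i),
    tsum_fintype]
  exact fun i j hij => (piece_disjoint ha hij).mono Set.inter_subset_right Set.inter_subset_right

/-- Interval exchange transformations preserve Lebesgue measure. -/
lemma measurePreserving_IE (σ : Equiv.Perm (Fin d)) {a : Fin d → ℝ} (ha : ∀ i, 0 ≤ a i) :
    MeasurePreserving (IE σ a) (volume.restrict (base a)) (volume.restrict (base a)) := by
  refine ⟨measurable_IE σ a, Measure.ext fun s hs => ?_⟩
  have hT := measurable_IE σ a hs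
  rw [Measure.map_apply (measurable_IE σ a) hs, Measure.restrict_apply hs,
    Measure.restrict_apply hT, volume_inter_base ha hT]
  have hb : base a = base (a ∘ σ.symm) := by rw [base, base, total_comp_symm]
  rw [hb, volume_inter_base (a := a ∘ σ.symm) (fun i => ha _) hs,
    ← Equiv.sum_comp σ fun i => volume (s ∩ piece (a ∘ σ.symm) i)]
  refine Finset.sum_congr rfl fun i _ => ?_
  have : IE σ a ⁻¹' s ∩ piece a i =
      (fun x => x + displacement σ a i) ⁻¹' (s ∩ piece (a ∘ σ.symm) (σ i)) := by
    ext x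
    simp only [Set.mem_inter_iff, Set.mem_preimage, add_displacement_mem_iff]
    refine and_congr_left fun hx => ?_
    rw [IE_of_mem_piece σ ha hx]
  rw [this, measure_preimage_add_right]

lemma total_smul (c : ℝ) (a : Fin d → ℝ) : total (c • a) = c * total a := by
  simp [total, Finset.mul_sum]

lemma leftEnd_smul (c : ℝ) (a : Fin d → ℝ) (i : Fin d) : leftEnd (c • a) i = c * leftEnd a i := by
  simp [leftEnd, Finset.mul_sum]

lemma newLeftEnd_smul (σ : Equiv.Perm (Fin d)) (c : ℝ) (a : Fin d → ℝ) (i : Fin d) :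
    newLeftEnd σ (c • a) i = c * newLeftEnd σ a i := by
  simp [newLeftEnd, Finset.mul_sum]

lemma displacement_smul (σ : Equiv.Perm (Fin d)) (c : ℝ) (a : Fin d → ℝ) (i : Fin d) :
    displacement σ (c • a) i = c * displacement σ a i := by
  rw [displacement, displacement, newLeftEnd_smul, leftEnd_smul]
  ring

lemma IE_smul (σ : Equiv.Perm (Fin d)) {c : ℝ} (hc : 0 < c) {a : Fin d → ℝ} (ha : ∀ i, 0 ≤ a i)
    {x : ℝ} (hx : x ∈ base a) : IE σ (c • a) (c * x) = c * IE σ a x := by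
  obtain ⟨i, hi⟩ := exists_mem_piece hx
  have hi' : c * x ∈ piece (c • a) i := by
    rw [piece, leftEnd_smul, Pi.smul_apply, smul_eq_mul, ← mul_add]
    exact ⟨mul_le_mul_of_nonneg_left hi.1 hc.le, mul_lt_mul_of_pos_left hi.2 hc⟩
  rw [IE_of_mem_piece σ (a := c • a) (fun i => mul_nonneg hc.le (ha i)) hi', IE_of_mem_piece σ ha hi,
    displacement_smul, mul_add]

/-- All the pointwise periods divide `N!`. -/
lemma periodic_of_bounded_periods {σ : Equiv.Perm (Fin d)} {a : Fin d → ℝ} (N : ℕ)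
    (h : ∀ x ∈ base a, ∃ m, 0 < m ∧ m ≤ N ∧ (IE σ a)^[m] x = x) : Periodic σ a := by
  refine ⟨N.factorial, N.factorial_pos, fun x hx => ?_⟩
  obtain ⟨m, hm, hmN, hp⟩ := h x hx
  obtain ⟨k, hk⟩ := Nat.dvd_factorial hm hmN
  rw [hk]
  exact (show Function.IsPeriodicPt (IE σ a) m x from hp).mul_const k

/-- The increments of `f` over subintervals of the exchanged intervals are invariant under the
exchange. This is the invariance of the measure with distribution function `f`. -/
structure InvariantDistribution (σ : Equiv.Perm (Fin d)) (a : Fin d → ℝ) (f : ℝ → ℝ) : Prop where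
  zero : f 0 = 0
  mono : ∀ x y, 0 ≤ x → x ≤ y → y ≤ total a → f x ≤ f y
  invariant : ∀ i x y, leftEnd a i ≤ x → x ≤ y → y ≤ leftEnd a i + a i →
    f (y + displacement σ a i) - f (x + displacement σ a i) = f y - f x

lemma invariantDistribution_id (σ : Equiv.Perm (Fin d)) (a : Fin d → ℝ) :
    InvariantDistribution σ a id :=
  ⟨rfl, fun _ _ _ h _ => h, fun _ _ _ _ _ _ => by simp⟩

lemma measure_Ico_zero_sub {μ : Measure ℝ} [IsFiniteMeasure μ] {x y : ℝ} (hx : 0 ≤ x)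
    (hxy : x ≤ y) : μ.real (Set.Ico 0 y) - μ.real (Set.Ico 0 x) = μ.real (Set.Ico x y) := by
  rw [← Set.Ico_union_Ico_eq_Ico hx hxy, measureReal_union _ measurableSet_Ico]
  · ring
  · rw [Set.disjoint_left]
    exact fun z h1 h2 => absurd h1.2 (not_lt.2 h2.1)

lemma invariantDistribution_of_measurePreserving {σ : Equiv.Perm (Fin d)} {a : Fin d → ℝ}
    (ha : ∀ i, 0 ≤ a i) {μ : Measure ℝ} [IsFiniteMeasure μ]
    (h : MeasurePreserving (IE σ a) μ μ) :
    InvariantDistribution σ a fun x => μ.real (Set.Ico 0 x) := by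
  refine ⟨by simp, fun x y _ hxy _ => measureReal_mono (Set.Ico_subset_Ico_right hxy), ?_⟩
  intro i x y hx hxy hy
  have hx0 := (leftEnd_nonneg ha i).trans hx
  have hx1 : 0 ≤ x + displacement σ a i := by
    have : 0 ≤ newLeftEnd σ a i := Finset.sum_nonneg fun j _ => ha j
    rw [displacement]
    linarith
  rw [measure_Ico_zero_sub hx0 hxy, measure_Ico_zero_sub hx1 (by linarith)]
  -- Injectivity of the exchange excludes preimages outside the `i`-th interval.
  have hpre : IE σ a ⁻¹' Set.Ico (x + displacement σ a i) (y + displacement σ a i) =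
      Set.Ico x y := by
    have hmem : ∀ z ∈ Set.Ico x y, IE σ a z = z + displacement σ a i := fun z hz =>
      IE_of_mem_piece σ ha ⟨hx.trans hz.1, hz.2.trans_le hy⟩
    ext z
    constructor
    · intro hz
      have hw : IE σ a z - displacement σ a i ∈ Set.Ico x y := by
        rw [Set.mem_preimage, Set.mem_Ico] at hz
        constructor <;> linarith
      have := hmem _ hw
      rw [sub_add_cancel] at this
      rwa [IE_injective σ ha this] at hw
    · intro hz
      rw [Set.mem_preimage, hmem z hz]
      exact ⟨by linarith [hz.1], by linarith [hz.2]⟩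
  rw [← hpre, h.measureReal_preimage measurableSet_Ico.nullMeasurableSet]

end General

/-! ### Perron contraction for backward orbits -/

section Perron

variable {d : ℕ}

/-- Measure `z` from its minimum, attained at `p`. Every row gives `p` weight at least `η`, so each
average lies between `0` and `(1 - η) B`. -/
lemma stochastic_oscillation_le {P : Fin d → Fin d → ℝ} {η : ℝ} (hη : 0 < η)
    (hP : ∀ i j, η ≤ P i j) (hsum : ∀ i, ∑ j, P i j = 1) {z : Fin d → ℝ} {B : ℝ}
    (hz : ∀ j j', z j - z j' ≤ B) (i i' : Fin d) :
    ∑ j, P i j * z j - ∑ j, P i' j * z j ≤ (1 - η) * B := by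
  obtain ⟨p, -, hp⟩ := Finset.exists_min_image Finset.univ z ⟨i, Finset.mem_univ i⟩
  have hB : 0 ≤ B := by simpa using hz i i
  have key : ∀ k, ∑ j, P k j * z j = ∑ j, P k j * (z j - z p) + z p := by
    intro k
    simp only [mul_sub, Finset.sum_sub_distrib, ← Finset.sum_mul, hsum]
    ring
  have h1 : ∑ j, P i j * (z j - z p) ≤ (1 - η) * B := by
    rw [← Finset.add_sum_erase _ _ (Finset.mem_univ p)]
    have hs := hsum i
    rw [← Finset.add_sum_erase _ _ (Finset.mem_univ p)] at hs
    have h2 : ∑ j ∈ Finset.univ.erase p, P i j * (z j - z p) ≤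
        ∑ j ∈ Finset.univ.erase p, P i j * B :=
      Finset.sum_le_sum fun j _ => mul_le_mul_of_nonneg_left (hz j p) (hη.le.trans (hP i j))
    rw [← Finset.sum_mul] at h2
    have h3 : (∑ j ∈ Finset.univ.erase p, P i j) * B ≤ (1 - η) * B :=
      mul_le_mul_of_nonneg_right (by linarith [hP i p]) hB
    simp only [sub_self, mul_zero, zero_add]
    exact h2.trans h3
  have h4 : 0 ≤ ∑ j, P i' j * (z j - z p) :=
    Finset.sum_nonneg fun j _ =>
      mul_nonneg (hη.le.trans (hP i' j)) (sub_nonneg.2 (hp j (Finset.mem_univ j)))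
  rw [key i, key i']
  linarith

/-- Nonnegativity bounds the whole backward orbit by `y 0 i / η`, since a larger entry would
propagate forward to time `0`. The oscillation at time `0` is then at most `(1 - η)ⁿ` times a fixed
bound. -/
lemma stochastic_backward_orbit_constant {P : Fin d → Fin d → ℝ} {η : ℝ} (hη : 0 < η)
    (hP : ∀ i j, η ≤ P i j) (hsum : ∀ i, ∑ j, P i j = 1) {y : ℕ → Fin d → ℝ}
    (hy0 : ∀ n i, 0 ≤ y n i) (hy : ∀ n i, y n i = ∑ j, P i j * y (n + 1) j) (i i' : Fin d) :
    y 0 i = y 0 i' := by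
  have hlow : ∀ n t, (∀ i, t ≤ y n i) → ∀ i, t ≤ y 0 i := by
    intro n t
    induction n with
    | zero => exact id
    | succ n ih =>
      refine fun h => ih fun i => ?_
      rw [hy, ← one_mul t, ← hsum i, Finset.sum_mul]
      exact Finset.sum_le_sum fun j _ => mul_le_mul_of_nonneg_left (h j) (hη.le.trans (hP i j))
  have hup : ∀ n j i, y (n + 1) j ≤ y 0 i / η := by
    intro n j i
    rw [le_div_iff₀ hη]
    refine hlow n _ (fun k => ?_) i
    rw [hy n k]
    refine le_trans ?_ (Finset.single_le_sum (f := fun j => P k j * y (n + 1) j)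
      (fun j _ => mul_nonneg (hη.le.trans (hP k j)) (hy0 _ _)) (Finset.mem_univ j))
    rw [mul_comm]
    exact mul_le_mul_of_nonneg_right (hP k j) (hy0 _ _)
  have hη1 : η ≤ 1 := by
    rw [← hsum i]
    exact (hP i i).trans (Finset.single_le_sum (f := fun j => P i j)
      (fun j _ => hη.le.trans (hP i j)) (Finset.mem_univ i))
  have hosc : ∀ n B, (∀ j j', y n j - y n j' ≤ B) →
      ∀ j j', y 0 j - y 0 j' ≤ (1 - η) ^ n * B := by
    intro n
    induction n with
    | zero => intro B h; simpa using h
    | succ n ih =>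
      intro B h
      rw [pow_succ, mul_assoc]
      refine ih _ fun j j' => ?_
      rw [hy n j, hy n j']
      exact stochastic_oscillation_le hη hP hsum h j j'
  have hle : ∀ j j', y 0 j - y 0 j' ≤ 0 := by
    intro j j'
    -- The exponent is `n + 1` because the bound `hup` holds only from time `1` on.
    have hlim : Filter.Tendsto (fun n : ℕ => (1 - η) ^ (n + 1) * (y 0 i / η)) Filter.atTop
        (nhds (0 * (y 0 i / η))) :=
      ((tendsto_pow_atTop_nhds_zero_of_lt_one (by linarith) (by linarith)).comp
        (Filter.tendsto_add_atTop_nat 1)).mul_const _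
    rw [zero_mul] at hlim
    refine ge_of_tendsto' hlim fun n => hosc (n + 1) _ (fun k k' => ?_) j j'
    linarith [hup n k i, hy0 (n + 1) k']
  exact le_antisymm (sub_nonpos.1 (hle i i')) (sub_nonpos.1 (hle i' i))

/-- Conjugating `M` by the diagonal matrix of the eigenvector `a` and normalising by `c` makes it
stochastic. The orbit `b n i / (cⁿ aᵢ)` is then constant in `i` at time `0`. -/
lemma proportional_of_backward_orbit_of_pos {M : Matrix (Fin d) (Fin d) ℝ}
    (hM : ∀ i j, 0 < M i j) {a : Fin d → ℝ} (ha : ∀ i, 0 < a i) {c : ℝ} (hc : 0 < c)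
    (hMa : M.mulVec (c • a) = a) {b : ℕ → Fin d → ℝ} (hb0 : ∀ n i, 0 ≤ b n i)
    (hb : ∀ n, b n = M.mulVec (b (n + 1))) (i j : Fin d) : b 0 i * a j = b 0 j * a i := by
  have hPpos : ∀ i j, 0 < M i j * (c * a j) / a i := fun i j =>
    div_pos (mul_pos (hM i j) (mul_pos hc (ha j))) (ha i)
  obtain ⟨p, -, hp⟩ := Finset.exists_min_image Finset.univ
    (fun q : Fin d × Fin d => M q.1 q.2 * (c * a q.2) / a q.1) ⟨(i, i), Finset.mem_univ _⟩
  have h := stochastic_backward_orbit_constant (P := fun i j => M i j * (c * a j) / a i)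
    (hPpos p.1 p.2) (fun i j => hp (i, j) (Finset.mem_univ _)) ?_
    (y := fun n i => b n i / (c ^ n * a i))
    (fun n i => div_nonneg (hb0 n i) (mul_pos (pow_pos hc n) (ha i)).le) ?_ i j
  · simp only [pow_zero, one_mul] at h
    rwa [div_eq_div_iff (ha i).ne' (ha j).ne'] at h
  · intro i
    rw [← Finset.sum_div, div_eq_one_iff_eq (ha i).ne']
    exact congrFun hMa i
  · intro n i
    have := congrFun (hb n) i
    rw [Matrix.mulVec, dotProduct] at this
    rw [this, Finset.sum_div]
    refine Finset.sum_congr rfl fun j _ => ?_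
    have := (ha i).ne'
    have := (ha j).ne'
    have := hc.ne'
    field_simp
    ring

/-- Perron's contraction argument: backward orbits of a primitive matrix in the positive cone are
proportional to the positive eigenvector. -/
lemma proportional_of_backward_orbit {M : Matrix (Fin d) (Fin d) ℝ} {k : ℕ}
    (hM : ∀ i j, 0 < (M ^ k) i j) {a : Fin d → ℝ} (ha : ∀ i, 0 < a i) {c : ℝ} (hc : 0 < c)
    (hMa : M.mulVec (c • a) = a) {b : ℕ → Fin d → ℝ} (hb0 : ∀ n i, 0 ≤ b n i)
    (hb : ∀ n, b n = M.mulVec (b (n + 1))) (i j : Fin d) : b 0 i * a j = b 0 j * a i := by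
  have hpow : ∀ m n, b n = (M ^ m).mulVec (b (n + m)) := by
    intro m
    induction m with
    | zero => simp
    | succ m ih =>
      intro n
      rw [ih n, hb (n + m), Matrix.mulVec_mulVec, ← pow_succ, add_assoc]
  have hpowa : ∀ m, (M ^ m).mulVec (c ^ m • a) = a := by
    intro m
    induction m with
    | zero => simp
    | succ m ih =>
      rw [pow_succ, pow_succ, ← Matrix.mulVec_mulVec, mul_smul, Matrix.mulVec_smul, hMa, ih]
  have h := proportional_of_backward_orbit_of_pos hM ha (pow_pos hc k) (hpowa k)
    (b := fun n => b (n * k)) (fun n => hb0 _) (fun n => ?_) i j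
  · simpa using h
  · rw [hpow k (n * k), Nat.succ_mul]

end Perron

/-! ### Induced exchanges and their towers -/

section Renormalisation

variable {d : ℕ}

/-- The total translation along the itinerary `w`. -/
noncomputable def drift (σ : Equiv.Perm (Fin d)) (a : Fin d → ℝ) (w : List (Fin d)) : ℝ :=
  (w.map (displacement σ a)).sum

lemma drift_nil (σ : Equiv.Perm (Fin d)) (a : Fin d → ℝ) : drift σ a [] = 0 := rfl

lemma drift_cons (σ : Equiv.Perm (Fin d)) (a : Fin d → ℝ) (i : Fin d) (w : List (Fin d)) :
    drift σ a (i :: w) = displacement σ a i + drift σ a w := by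
  simp [drift]

/-- The interval with endpoints `x`, `y` has itinerary `w`. -/
def Follows (σ : Equiv.Perm (Fin d)) (a : Fin d → ℝ) : ℝ → ℝ → List (Fin d) → Prop
  | _, _, [] => True
  | x, y, i :: w => leftEnd a i ≤ x ∧ y ≤ leftEnd a i + a i ∧
      Follows σ a (x + displacement σ a i) (y + displacement σ a i) w

lemma Follows.take {σ : Equiv.Perm (Fin d)} {a : Fin d → ℝ} {x y : ℝ} {w : List (Fin d)}
    (h : Follows σ a x y w) (k : ℕ) : Follows σ a x y (w.take k) := by
  induction w generalizing x y k with
  | nil => simpa using h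
  | cons i w ih =>
    cases k with
    | zero => trivial
    | succ k => exact ⟨h.1, h.2.1, ih h.2.2 k⟩

lemma Follows.iterate {σ : Equiv.Perm (Fin d)} {a : Fin d → ℝ} (ha : ∀ i, 0 ≤ a i) {x y z : ℝ}
    {w : List (Fin d)} (h : Follows σ a x y w) (hz : z ∈ Set.Ico x y) :
    (IE σ a)^[w.length] z = z + drift σ a w := by
  induction w generalizing x y z with
  | nil => simp [drift_nil]
  | cons i w ih =>
    rw [List.length_cons, Function.iterate_succ_apply,
      IE_of_mem_piece σ ha ⟨h.1.trans hz.1, hz.2.trans_le h.2.1⟩,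
      ih h.2.2 ⟨by linarith [hz.1], by linarith [hz.2]⟩, drift_cons, add_assoc]

lemma Follows.increment {σ : Equiv.Perm (Fin d)} {a : Fin d → ℝ} {x y x' y' : ℝ}
    {w : List (Fin d)} (h : Follows σ a x y w) {f : ℝ → ℝ} (hf : InvariantDistribution σ a f)
    (hx : x ≤ x') (hxy : x' ≤ y') (hy : y' ≤ y) :
    f (y' + drift σ a w) - f (x' + drift σ a w) = f y' - f x' := by
  induction w generalizing x y x' y' with
  | nil => simp [drift_nil]
  | cons i w ih =>
    have := ih h.2.2 (x' := x' + displacement σ a i) (y' := y' + displacement σ a i)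
      (by linarith) (by linarith) (by linarith)
    rw [drift_cons, ← add_assoc, ← add_assoc, this,
      hf.invariant i x' y' (h.1.trans hx) hxy (hy.trans h.2.1)]

/-- The intervals in the list `l` are consecutive and fill the interval with endpoints `p`, `q`. -/
def Consecutive : List (ℝ × ℝ) → ℝ → ℝ → Prop
  | [], p, q => p = q
  | I :: l, p, q => I.1 = p ∧ Consecutive l I.2 q

lemma Consecutive.exists_mem {l : List (ℝ × ℝ)} {p q x : ℝ} (h : Consecutive l p q)
    (hx : x ∈ Set.Ico p q) : ∃ I ∈ l, x ∈ Set.Ico I.1 I.2 := by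
  induction l generalizing p with
  | nil => rw [show p = q from h] at hx; simp at hx
  | cons I l ih =>
    by_cases hI : x < I.2
    · exact ⟨I, by simp, h.1 ▸ hx.1, hI⟩
    · obtain ⟨K, hK, hxK⟩ := ih h.2 ⟨not_lt.1 hI, hx.2⟩
      exact ⟨K, by simp [hK], hxK⟩

lemma Consecutive.sum_increment {l : List (ℝ × ℝ)} {p q : ℝ} (h : Consecutive l p q)
    (f : ℝ → ℝ) : (l.map fun I => f I.2 - f I.1).sum = f q - f p := by
  induction l generalizing p with
  | nil => rw [show p = q from h]; simp
  | cons I l ih =>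
    rw [List.map_cons, List.sum_cons, ih h.2, h.1]
    ring

lemma Consecutive.left_eq {l : List (ℝ × ℝ)} {p q : ℝ} (h : Consecutive l p q)
    {g : ℝ → ℝ} (hp : g p = 0) (hl : ∀ I ∈ l, g I.2 = g I.1) : ∀ I ∈ l, g I.1 = 0 := by
  induction l generalizing p with
  | nil => simp
  | cons I l ih =>
    have h0 : g I.1 = 0 := by rw [h.1, hp]
    intro K hK
    rcases List.mem_cons.1 hK with rfl | hK
    · exact h0
    · exact ih h.2 (by rw [hl I (by simp), h0]) (fun K hK => hl K (by simp [hK])) K hK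

/-- The `k`-th floor of the tower over the `i`-th interval of `u + [0, |b|)`. -/
noncomputable def floorInterval (σ : Equiv.Perm (Fin d)) (a b : Fin d → ℝ) (u : ℝ)
    (w : Fin d → List (Fin d)) (t : Fin d × ℕ) : ℝ × ℝ :=
  (u + leftEnd b t.1 + drift σ a ((w t.1).take t.2),
    u + leftEnd b t.1 + b t.1 + drift σ a ((w t.1).take t.2))

/-- The interval exchange `IE_σ(a)` induces `IE_σ(b)` on `u + [0, |b|)`: the intervals of the
induced map have itineraries `w`, and the floors of the towers over them tile the intervals of
`IE_σ(a)` as recorded in `tiles`. -/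
structure Renormalises (σ : Equiv.Perm (Fin d)) (a b : Fin d → ℝ) (u : ℝ)
    (w : Fin d → List (Fin d)) (tiles : Fin d → List (Fin d × ℕ)) : Prop where
  nonneg : ∀ i, 0 ≤ a i
  nonneg' : ∀ i, 0 ≤ b i
  ne_nil : ∀ i, w i ≠ []
  follows : ∀ i, Follows σ a (u + leftEnd b i) (u + leftEnd b i + b i) (w i)
  drift_eq : ∀ i, drift σ a (w i) = displacement σ b i
  outside : ∀ i k, 0 < k → k < (w i).length →
    u + leftEnd b i + b i + drift σ a ((w i).take k) ≤ u ∨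
      u + total b ≤ u + leftEnd b i + drift σ a ((w i).take k)
  consecutive : ∀ j, Consecutive ((tiles j).map (floorInterval σ a b u w))
    (leftEnd a j) (leftEnd a j + a j)
  height : ∀ j, ∀ t ∈ tiles j, t.2 < (w t.1).length

namespace Renormalises

variable {σ : Equiv.Perm (Fin d)} {a b : Fin d → ℝ} {u : ℝ} {w : Fin d → List (Fin d)}
  {tiles : Fin d → List (Fin d × ℕ)}

lemma iterate_floor (h : Renormalises σ a b u w tiles) {x : ℝ} {i : Fin d}
    (hi : x - u ∈ piece b i) {k : ℕ} (hk : k ≤ (w i).length) :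
    (IE σ a)^[k] x = x + drift σ a ((w i).take k) := by
  have := ((h.follows i).take k).iterate h.nonneg (z := x)
    ⟨by linarith [hi.1], by linarith [hi.2]⟩
  rwa [List.length_take, min_eq_left hk] at this

lemma iterate_return (h : Renormalises σ a b u w tiles) {x : ℝ} {i : Fin d}
    (hi : x - u ∈ piece b i) :
    (IE σ a)^[(w i).length] x = u + IE σ b (x - u) := by
  rw [h.iterate_floor hi le_rfl, List.take_length, h.drift_eq, IE_of_mem_piece σ h.nonneg' hi]
  ring

lemma sub_mem_base {x : ℝ} (hx : x ∈ Set.Ico u (u + total b)) : x - u ∈ base b :=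
  ⟨by linarith [hx.1], by linarith [hx.2]⟩

lemma isFirstReturn (h : Renormalises σ a b u w tiles) {x : ℝ}
    (hx : x ∈ Set.Ico u (u + total b)) :
    IsFirstReturn (IE σ a) (Set.Ico u (u + total b)) x (u + IE σ b (x - u)) := by
  obtain ⟨i, hi⟩ := exists_mem_piece (sub_mem_base hx)
  refine ⟨(w i).length, List.length_pos_iff.2 (h.ne_nil i), h.iterate_return hi, ?_, ?_⟩
  · have := IE_mem_base σ h.nonneg' (sub_mem_base hx)
    exact ⟨by linarith [this.1], by linarith [this.2]⟩
  · intro k hk hkl hmem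
    rw [h.iterate_floor hi hkl.le] at hmem
    rcases h.outside i k hk hkl with h1 | h1
    · linarith [hmem.1, hi.2]
    · linarith [hmem.2, hi.1]

/-- The floors tile the base, so every point can be pulled down its tower. -/
lemma exists_iterate (h : Renormalises σ a b u w tiles) {x : ℝ} (hx : x ∈ base a) :
    ∃ y ∈ Set.Ico u (u + total b), ∃ k, (IE σ a)^[k] y = x := by
  obtain ⟨j, hj⟩ := exists_mem_piece hx
  obtain ⟨I, hI, hxI⟩ := (h.consecutive j).exists_mem hj
  obtain ⟨t, ht, rfl⟩ := List.mem_map.1 hI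
  set δ := drift σ a ((w t.1).take t.2) with hδ
  have h1 : u + leftEnd b t.1 + δ ≤ x := hxI.1
  have h2 : x < u + leftEnd b t.1 + b t.1 + δ := hxI.2
  have hp : x - δ - u ∈ piece b t.1 := ⟨by linarith, by linarith⟩
  refine ⟨x - δ, ?_, t.2, ?_⟩
  · have := piece_subset_base h.nonneg' _ hp
    exact ⟨by linarith [this.1], by linarith [this.2]⟩
  · rw [h.iterate_floor hp (h.height j t ht).le]
    ring

lemma periodic (h : Renormalises σ a b u w tiles) (hb : Periodic σ b) : Periodic σ a := by
  obtain ⟨n, hn, hper⟩ := hb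
  obtain ⟨K, hK⟩ : ∃ K, ∀ i, (w i).length ≤ K :=
    ⟨∑ i, (w i).length, fun i => Finset.single_le_sum (f := fun i => (w i).length)
      (fun _ _ => Nat.zero_le _) (Finset.mem_univ i)⟩
  -- The lower bound on `N` keeps the resulting period positive; the upper bound makes the periods
  -- uniformly bounded.
  have hiter : ∀ m, ∀ x ∈ Set.Ico u (u + total b), ∃ N, m ≤ N ∧ N ≤ m * K ∧
      (IE σ a)^[N] x = u + (IE σ b)^[m] (x - u) := by
    intro m
    induction m with
    | zero => intro x _; exact ⟨0, le_rfl, by simp, by simp⟩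
    | succ m ih =>
      intro x hx
      obtain ⟨i, hi⟩ := exists_mem_piece (sub_mem_base hx)
      have hmem := IE_mem_base σ h.nonneg' (sub_mem_base hx)
      obtain ⟨N, h1, h2, h3⟩ := ih (u + IE σ b (x - u))
        ⟨by linarith [hmem.1], by linarith [hmem.2]⟩
      have := List.length_pos_iff.2 (h.ne_nil i)
      refine ⟨N + (w i).length, by omega, ?_, ?_⟩
      · rw [Nat.succ_mul]; exact Nat.add_le_add h2 (hK i)
      · rw [Function.iterate_add_apply, h.iterate_return hi, h3, Function.iterate_succ_apply,
          add_sub_cancel_left]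
  refine periodic_of_bounded_periods (n * K) fun x hx => ?_
  obtain ⟨y, hy, k, rfl⟩ := h.exists_iterate hx
  obtain ⟨N, h1, h2, h3⟩ := hiter n y hy
  refine ⟨N, by omega, h2, ?_⟩
  rw [← Function.iterate_add_apply, add_comm, Function.iterate_add_apply, h3,
    hper _ (sub_mem_base hy)]
  congr 1
  ring

end Renormalises

/-- The increment of `f` over the `i`-th interval. -/
noncomputable def mass (a : Fin d → ℝ) (f : ℝ → ℝ) (i : Fin d) : ℝ :=
  f (leftEnd a i + a i) - f (leftEnd a i)

lemma mass_nonneg {σ : Equiv.Perm (Fin d)} {a : Fin d → ℝ} (ha : ∀ i, 0 ≤ a i) {f : ℝ → ℝ}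
    (hf : InvariantDistribution σ a f) (i : Fin d) : 0 ≤ mass a f i :=
  sub_nonneg.2 (hf.mono _ _ (leftEnd_nonneg ha i) (by linarith [ha i]) (rightEnd_le_total ha i))

/-- The number of floors over the `i`-th interval of the induced map in the `j`-th interval. -/
def incidence (tiles : Fin d → List (Fin d × ℕ)) (j i : Fin d) : ℕ :=
  ((tiles j).map Prod.fst).count i

lemma list_sum_eq_sum_count (l : List (Fin d)) (m : Fin d → ℝ) :
    (l.map m).sum = ∑ i, (l.count i : ℝ) * m i := by
  rw [← Finset.sum_subset (Finset.subset_univ l.toFinset)]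
  · simp only [← nsmul_eq_mul]
    exact (Finset.sum_list_map_count l m)
  · intro i _ hi
    rw [List.mem_toFinset] at hi
    simp [List.count_eq_zero_of_not_mem hi]

/-! ### Unique ergodicity of self-similar exchanges -/

section SelfSimilar

variable {σ : Equiv.Perm (Fin d)} {a : Fin d → ℝ} {c u : ℝ} {w : Fin d → List (Fin d)}
  {tiles : Fin d → List (Fin d × ℕ)}

/-- The rescaled restriction of `f` to `[u, u + c|a|)`. -/
def rescale (c u : ℝ) (f : ℝ → ℝ) (x : ℝ) : ℝ := f (u + c * x) - f u

lemma Renormalises.increment_floor (h : Renormalises σ a (c • a) u w tiles) {f : ℝ → ℝ}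
    (hf : InvariantDistribution σ a f) {i : Fin d} (hc : 0 < c) {x y : ℝ} (hx : leftEnd a i ≤ x)
    (hxy : x ≤ y) (hy : y ≤ leftEnd a i + a i) (k : ℕ) :
    f (u + c * y + drift σ a ((w i).take k)) - f (u + c * x + drift σ a ((w i).take k)) =
      rescale c u f y - rescale c u f x := by
  rw [((h.follows i).take k).increment hf (x' := u + c * x) (y' := u + c * y)]
  · simp [rescale]
  · rw [leftEnd_smul]
    linarith [mul_le_mul_of_nonneg_left hx hc.le]
  · linarith [mul_le_mul_of_nonneg_left hxy hc.le]
  · rw [leftEnd_smul, Pi.smul_apply, smul_eq_mul]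
    linarith [mul_le_mul_of_nonneg_left hy hc.le]

lemma Renormalises.rescale_invariant (h : Renormalises σ a (c • a) u w tiles)
    (hc : 0 < c) (hu : 0 ≤ u) (hut : u + c * total a ≤ total a) {f : ℝ → ℝ}
    (hf : InvariantDistribution σ a f) : InvariantDistribution σ a (rescale c u f) := by
  refine ⟨by simp [rescale], fun x y hx hxy hy => ?_, fun i x y hx hxy hy => ?_⟩
  · have h1 := mul_le_mul_of_nonneg_left hxy hc.le
    have h2 := mul_le_mul_of_nonneg_left hy hc.le
    have h3 := mul_nonneg hc.le hx
    linarith [hf.mono (u + c * x) (u + c * y) (by linarith) (by linarith) (by linarith),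
      show rescale c u f x = f (u + c * x) - f u from rfl,
      show rescale c u f y = f (u + c * y) - f u from rfl]
  · rw [← h.increment_floor hf hc hx hxy hy (w i).length, List.take_length, h.drift_eq,
      displacement_smul]
    simp only [rescale, mul_add, add_assoc]
    ring

/-- Add up the increments over the floors tiling the `j`-th interval; by invariance each floor
carries the mass of the base of its tower. -/
lemma Renormalises.mass_eq (h : Renormalises σ a (c • a) u w tiles) (hc : 0 < c) {f : ℝ → ℝ}
    (hf : InvariantDistribution σ a f) (j : Fin d) :
    mass a f j = ∑ i, (incidence tiles j i : ℝ) * mass a (rescale c u f) i := by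
  have h1 := (h.consecutive j).sum_increment f
  simp only [incidence]
  rw [mass, ← h1, ← list_sum_eq_sum_count, List.map_map, List.map_map]
  congr 1
  refine List.map_congr_left fun t _ => ?_
  rw [Function.comp, Function.comp, mass, ← h.increment_floor hf hc le_rfl
    (by have := h.nonneg t.1; linarith) le_rfl t.2]
  simp only [floorInterval, leftEnd_smul, Pi.smul_apply, smul_eq_mul, mul_add, add_assoc]

lemma apply_partialSum {f : ℝ → ℝ} {κ : ℝ} (h0 : f 0 = 0)
    (hm : ∀ i, mass a f i = κ * a i) : ∀ n ≤ d, f (partialSum a n) = κ * partialSum a n := by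
  intro n
  induction n with
  | zero => intro _; simp [partialSum_zero, h0]
  | succ n ih =>
    intro hn
    have h1 := hm ⟨n, hn⟩
    have h2 := ih (by omega)
    have h3 := partialSum_succ a ⟨n, hn⟩
    rw [mass, leftEnd_eq_partialSum] at h1
    rw [leftEnd_eq_partialSum] at h3
    simp only at h1 h3
    rw [h3, mul_add, ← h2]
    linarith

/-- Iterated rescalings of `f` remain invariant, so by `mass_eq` their mass vectors form a backward
orbit of the incidence matrix. The case `f = id` supplies the positive eigenvector `a`. -/
lemma Renormalises.mass_eq_mul (h : Renormalises σ a (c • a) u w tiles) (hc : 0 < c) (hu : 0 ≤ u)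
    (hut : u + c * total a ≤ total a) (ha : ∀ i, 0 < a i) {k : ℕ}
    (hM : ∀ i j, 0 < (Matrix.of (fun i j => (incidence tiles i j : ℝ)) ^ k) i j)
    (ht : 0 < total a) {f : ℝ → ℝ} (hf : InvariantDistribution σ a f) (i : Fin d) :
    mass a f i = f (total a) / total a * a i := by
  have hinv : ∀ n, InvariantDistribution σ a ((rescale c u)^[n] f) := by
    intro n
    induction n with
    | zero => exact hf
    | succ n ih =>
      rw [Function.iterate_succ_apply']
      exact h.rescale_invariant hc hu hut ih
  have hMa : (Matrix.of fun i j => (incidence tiles i j : ℝ)).mulVec (c • a) = a := by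
    ext j
    have := h.mass_eq hc (invariantDistribution_id σ a) j
    simp only [mass, rescale, id] at this
    rw [add_sub_cancel_left] at this
    rw [this, Matrix.mulVec, dotProduct]
    refine Finset.sum_congr rfl fun i _ => ?_
    simp only [Matrix.of_apply, Pi.smul_apply, smul_eq_mul]
    ring
  have hprop : ∀ j, mass a f i * a j = mass a f j * a i := fun j =>
    proportional_of_backward_orbit hM ha hc hMa
      (b := fun n => mass a ((rescale c u)^[n] f))
      (fun n i => mass_nonneg (fun i => (ha i).le) (hinv n) i)
      (fun n => by
        ext j
        simp only [Function.iterate_succ_apply']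
        exact h.mass_eq hc (hinv n) j) i j
  have hi := (ha i).ne'
  have hm : ∀ j, mass a f j = mass a f i / a i * a j := fun j => by
    rw [div_mul_eq_mul_div, hprop j, mul_div_cancel_right₀ _ hi]
  have := apply_partialSum hf.zero hm d le_rfl
  rw [partialSum_self] at this
  rw [this, mul_div_cancel_right₀ _ ht.ne', div_mul_cancel₀ _ hi]

/-- The discrepancy vanishes at the left ends of the floors. Inside a floor it equals the
discrepancy of the rescaled distribution, whose total mass is smaller by the factor `c`; induction
on `n` repeats this at finer scales. -/
lemma Renormalises.discrepancy_le (h : Renormalises σ a (c • a) u w tiles) (hc : 0 < c)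
    (hu : 0 ≤ u) (hut : u + c * total a ≤ total a) (ha : ∀ i, 0 < a i) {k : ℕ}
    (hM : ∀ i j, 0 < (Matrix.of (fun i j => (incidence tiles i j : ℝ)) ^ k) i j)
    (ht : 0 < total a) (n : ℕ) {f : ℝ → ℝ} (hf : InvariantDistribution σ a f) {x : ℝ}
    (hx0 : 0 ≤ x) (hx1 : x ≤ total a) :
    |f x - f (total a) / total a * x| ≤ c ^ n * f (total a) := by
  induction n generalizing f x with
  | zero =>
    have h1 := hf.mono 0 x le_rfl hx0 hx1
    have h2 := hf.mono x _ hx0 hx1 le_rfl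
    have h3 := hf.mono 0 _ le_rfl ht.le le_rfl
    rw [hf.zero] at h1 h3
    have h4 : 0 ≤ f (total a) / total a * x := mul_nonneg (div_nonneg h3 ht.le) hx0
    have h5 : f (total a) / total a * x ≤ f (total a) := by
      rw [div_mul_eq_mul_div, div_le_iff₀ ht]
      exact mul_le_mul_of_nonneg_left hx1 h3
    rw [abs_le]
    constructor <;> simp <;> linarith
  | succ n ih =>
    have hg := h.rescale_invariant hc hu hut hf
    set κ := f (total a) / total a with hκ
    have hfm := h.mass_eq_mul hc hu hut ha hM ht hf
    have hgm := h.mass_eq_mul hc hu hut ha hM ht hg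
    set κ' := rescale c u f (total a) / total a with hκ'
    have hanz : ∀ i, a i ≠ 0 := fun i => (ha i).ne'
    obtain ⟨j₀, -⟩ : ∃ j : Fin d, True := by
      by_contra! hd
      have : total a = 0 := Finset.sum_eq_zero fun i _ => (hd i).elim
      exact ht.ne' this
    -- Compare the mass identity of `f` with that of the identity function, on one interval.
    have hκc : κ' = c * κ := by
      have h1 := h.mass_eq hc hf j₀
      have h2 := h.mass_eq hc (invariantDistribution_id σ a) j₀
      simp only [hgm] at h1
      rw [hfm] at h1
      have h3 : ∀ i, mass a (rescale c u id) i = c * a i := fun i => by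
        simp only [mass, rescale, id]; ring
      have h4 : mass a id j₀ = a j₀ := by simp [mass]
      simp only [h3, h4] at h2
      have h5 : κ * a j₀ * c = κ' * a j₀ := by
        rw [h1, h2, Finset.sum_mul, Finset.mul_sum]
        exact Finset.sum_congr rfl fun i _ => by ring
      exact mul_right_cancel₀ (hanz j₀) (by linarith)
    have hends := apply_partialSum hf.zero hfm
    have hends' := apply_partialSum hg.zero hgm
    rcases hx1.eq_or_lt with rfl | hlt
    · rw [hκ, div_mul_cancel₀ _ ht.ne', sub_self, abs_zero]
      have h3 := hf.mono 0 _ le_rfl ht.le le_rfl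
      rw [hf.zero] at h3
      exact mul_nonneg (pow_nonneg hc.le _) h3
    obtain ⟨j, hj⟩ := exists_mem_piece (a := a) ⟨hx0, hlt⟩
    obtain ⟨I, hI, hxI⟩ := (h.consecutive j).exists_mem hj
    have hleft := (h.consecutive j).left_eq (g := fun x => f x - κ * x) (by
      simp only [leftEnd_eq_partialSum]
      rw [hends j j.2.le, sub_self]) (by
        intro I hI
        obtain ⟨t, ht, rfl⟩ := List.mem_map.1 hI
        have h1 := h.increment_floor hf (i := t.1) hc le_rfl
          (by have := ha t.1; linarith) le_rfl t.2
        have h2 := hgm t.1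
        rw [mass] at h2
        rw [h2, hκc] at h1
        simp only [floorInterval, leftEnd_smul, Pi.smul_apply, smul_eq_mul, mul_add,
          add_assoc] at h1 ⊢
        linarith) I hI
    obtain ⟨t, ht', rfl⟩ := List.mem_map.1 hI
    set δ := drift σ a ((w t.1).take t.2) with hδ
    have h1 : u + c * leftEnd a t.1 + δ ≤ x := by
      rw [← leftEnd_smul]; exact hxI.1
    have h2 : x < u + c * leftEnd a t.1 + c * a t.1 + δ := by
      rw [← leftEnd_smul]; exact hxI.2
    -- The point `z` is `x` pulled down to the base of its tower and rescaled to the original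
    -- interval.
    obtain ⟨z, hz⟩ : ∃ z, x = u + c * z + δ := ⟨(x - u - δ) / c, by field_simp; ring⟩
    have hz0 : leftEnd a t.1 ≤ z := le_of_mul_le_mul_left (by linarith) hc
    have hz1 : z ≤ leftEnd a t.1 + a t.1 := le_of_mul_le_mul_left (by linarith) hc
    have h3 := h.increment_floor hf hc le_rfl hz0 hz1 t.2
    have h4 := hends' t.1 t.1.2.le
    rw [← leftEnd_eq_partialSum] at h4
    simp only [floorInterval, leftEnd_smul] at hleft
    rw [← hδ] at h3 hleft
    have h5 : f x - κ * x = rescale c u f z - κ' * z := by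
      rw [h4, hκc] at h3
      rw [hκc, hz]
      linarith
    have h6 := ih hg ((leftEnd_nonneg h.nonneg _).trans hz0)
      (hz1.trans (rightEnd_le_total h.nonneg _))
    have h7 : rescale c u f (total a) = c * f (total a) := by
      have h8 : rescale c u f (total a) = κ' * total a := by
        rw [hκ', div_mul_cancel₀ _ ht.ne']
      rw [h8, hκc, hκ]
      field_simp
    rw [h5]
    rw [← hκ', h7] at h6
    rw [pow_succ, mul_assoc]
    exact h6

lemma eq_smul_volume_of_measure_Ico {μ : Measure ℝ} [IsFiniteMeasure μ] {κ : NNReal}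
    (hμ : μ (base a)ᶜ = 0)
    (h : ∀ x, 0 ≤ x → x ≤ total a → μ.real (Set.Ico 0 x) = κ * x) :
    μ = κ • volume.restrict (base a) := by
  refine Measure.ext_of_Ico _ _ fun p q _ => ?_
  rw [Measure.smul_apply, Measure.restrict_apply measurableSet_Ico,
    ← measure_inter_add_sdiff (μ := μ) (Set.Ico p q) (t := base a) measurableSet_Ico,
    measure_mono_null (s := Set.Ico p q \ base a) (fun x hx => hx.2) hμ, add_zero, base, Set.Ico_inter_Ico]
  rcases lt_or_ge (min q (total a)) (max p 0) with hlt | hle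
  · rw [Set.Ico_eq_empty_of_le hlt.le]
    simp
  · have h1 := measure_Ico_zero_sub (μ := μ) (le_max_right p 0) hle
    rw [h _ ((le_max_right p 0).trans hle) (min_le_right _ _),
      h _ (le_max_right p 0) (hle.trans (min_le_right _ _)), ← mul_sub] at h1
    have h0 : (0 : ℝ) ≤ min q (total a) - max p 0 := sub_nonneg.2 hle
    rw [← ofReal_measureReal, ← h1, Real.volume_Ico,
      ENNReal.ofReal_mul (p := (κ : ℝ)) κ.2, ENNReal.ofReal_coe_nnreal]
    rfl

/-- A self-similar interval exchange with primitive incidence matrix is uniquely ergodic. -/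
theorem Renormalises.uniquelyErgodic (h : Renormalises σ a (c • a) u w tiles) (hc : 0 < c)
    (hc1 : c < 1) (hu : 0 ≤ u) (hut : u + c * total a ≤ total a) (ha : ∀ i, 0 < a i) {k : ℕ}
    (hM : ∀ i j, 0 < (Matrix.of (fun i j => (incidence tiles i j : ℝ)) ^ k) i j)
    (ht : 0 < total a) : UniquelyErgodic σ a := by
  intro μ hfin hμ
  constructor
  · intro hpres
    have hf := invariantDistribution_of_measurePreserving (fun i => (ha i).le) hpres
    have hκ : 0 ≤ μ.real (Set.Ico 0 (total a)) / total a := div_nonneg measureReal_nonneg ht.le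
    refine ⟨⟨_, hκ⟩, eq_smul_volume_of_measure_Ico hμ fun x hx0 hx1 => ?_⟩
    have hlim : Filter.Tendsto (fun n : ℕ => c ^ n * μ.real (Set.Ico 0 (total a))) Filter.atTop
        (nhds (0 * μ.real (Set.Ico 0 (total a)))) :=
      (tendsto_pow_atTop_nhds_zero_of_lt_one hc.le hc1).mul_const _
    rw [zero_mul] at hlim
    have := ge_of_tendsto' hlim fun n => h.discrepancy_le hc hu hut ha hM ht n hf hx0 hx1
    exact sub_eq_zero.1 (abs_nonpos_iff.1 this)
  · rintro ⟨κ, rfl⟩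
    exact (measurePreserving_IE σ fun i => (ha i).le).smul_measure κ

end SelfSimilar

end Renormalisation

lemma periodic_smul {d : ℕ} {σ : Equiv.Perm (Fin d)} {a : Fin d → ℝ} (ha : ∀ i, 0 ≤ a i) {c : ℝ}
    (hc : 0 < c) (h : Periodic σ a) : Periodic σ (c • a) := by
  obtain ⟨n, hn, hper⟩ := h
  refine ⟨n, hn, fun x hx => ?_⟩
  rw [base, total_smul] at hx
  obtain ⟨z, rfl⟩ : ∃ z, x = c * z := ⟨x / c, by field_simp⟩
  have hz : z ∈ base a :=
    ⟨nonneg_of_mul_nonneg_right hx.1 hc, lt_of_mul_lt_mul_left hx.2 hc.le⟩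
  have : ∀ m, (IE σ (c • a))^[m] (c * z) = c * (IE σ a)^[m] z ∧ (IE σ a)^[m] z ∈ base a := by
    intro m
    induction m with
    | zero => exact ⟨rfl, hz⟩
    | succ m ih =>
      rw [Function.iterate_succ_apply', Function.iterate_succ_apply', ih.1, IE_smul σ hc ha ih.2]
      exact ⟨rfl, IE_mem_base σ ha ih.2⟩
  rw [(this n).1, hper z hz]

/-! ### Exact arithmetic with the tribonacci constant and a parameter -/

namespace Tribonacci

/-- Formal combinations of `1`, `l`, `l²` and the deformation parameter. -/
abbrev Form := ℤ × ℤ × ℤ × ℤ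

/-- The value of a formal combination. -/
noncomputable def eval (l e : ℝ) : Form →+ ℝ where
  toFun v := v.1 + v.2.1 * l + v.2.2.1 * l ^ 2 + v.2.2.2 * e
  map_zero' := by simp
  map_add' v w := by
    simp only [Prod.fst_add, Prod.snd_add, Int.cast_add]
    ring

lemma eval_apply (l e : ℝ) (v : Form) :
    eval l e v = v.1 + v.2.1 * l + v.2.2.1 * l ^ 2 + v.2.2.2 * e := rfl

/-- A sufficient condition for `x + y l + z l² ≥ 0` when `1.8392 ≤ l ≤ 1.8393`. -/
def quadNonneg (x y z : ℤ) : Bool :=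
  0 ≤ x * 10000 ^ 2 + y * (if 0 ≤ y then 18392 else 18393) * 10000 +
    z * (if 0 ≤ z then 18392 else 18393) ^ 2

/-- Interval arithmetic: each monomial is bounded below using the end of the range of `l` selected
by the sign of its coefficient. -/
lemma quadNonneg_sound {l : ℝ} (h1 : 1.8392 ≤ l) (h2 : l ≤ 1.8393) {x y z : ℤ}
    (h : quadNonneg x y z = true) : 0 ≤ x + y * l + z * l ^ 2 := by
  have h' := of_decide_eq_true h
  have hy : (y : ℝ) * ((if 0 ≤ y then 18392 else 18393 : ℤ) : ℝ) ≤ y * (10000 * l) := by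
    split_ifs with h0
    · have : (0 : ℝ) ≤ y := by exact_mod_cast h0
      exact mul_le_mul_of_nonneg_left (by push_cast; linarith) this
    · have : (y : ℝ) ≤ 0 := by exact_mod_cast (not_le.1 h0).le
      exact mul_le_mul_of_nonpos_left (by push_cast; linarith) this
  have hz : (z : ℝ) * ((if 0 ≤ z then 18392 else 18393 : ℤ) : ℝ) ^ 2 ≤ z * (10000 * l) ^ 2 := by
    split_ifs with h0
    · have : (0 : ℝ) ≤ z := by exact_mod_cast h0
      exact mul_le_mul_of_nonneg_left
        (pow_le_pow_left₀ (by norm_num) (by push_cast; linarith) 2) this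
    · have : (z : ℝ) ≤ 0 := by exact_mod_cast (not_le.1 h0).le
      exact mul_le_mul_of_nonpos_left
        (pow_le_pow_left₀ (by linarith) (by push_cast; linarith) 2) this
  have h'' : (0 : ℝ) ≤ x * 10000 ^ 2 + y * ((if 0 ≤ y then 18392 else 18393 : ℤ) : ℝ) * 10000 +
      z * ((if 0 ≤ z then 18392 else 18393 : ℤ) : ℝ) ^ 2 := by exact_mod_cast h'
  nlinarith

/-- A parameter range, given by its endpoints in `ℤ[l]`. -/
abbrev Range := (ℤ × ℤ × ℤ) × (ℤ × ℤ × ℤ)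

/-- The interval of parameters described by a range. -/
def Range.Mem (l e : ℝ) (R : Range) : Prop :=
  R.1.1 + R.1.2.1 * l + R.1.2.2 * l ^ 2 ≤ e ∧ e ≤ R.2.1 + R.2.2.1 * l + R.2.2.2 * l ^ 2

/-- A sufficient condition for a combination to be nonnegative on a range of parameters. -/
def nonnegOn (R : Range) (v : Form) : Bool :=
  quadNonneg (v.1 + v.2.2.2 * R.1.1) (v.2.1 + v.2.2.2 * R.1.2.1) (v.2.2.1 + v.2.2.2 * R.1.2.2) &&
  quadNonneg (v.1 + v.2.2.2 * R.2.1) (v.2.1 + v.2.2.2 * R.2.2.1) (v.2.2.1 + v.2.2.2 * R.2.2.2)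

/-- `l` is the tribonacci constant. -/
structure IsTribonacci (l : ℝ) : Prop where
  lower : 1.8392 ≤ l
  upper : l ≤ 1.8393
  cube : l ^ 3 = l ^ 2 + l + 1

lemma exists_isTribonacci : ∃ l, IsTribonacci l := by
  have hc : ContinuousOn (fun x : ℝ => x ^ 3 - x ^ 2 - x - 1) (Set.Icc 1.8392 1.8393) := by
    fun_prop
  obtain ⟨l, hl, h0⟩ := intermediate_value_Icc (by norm_num) hc
    (show (0 : ℝ) ∈ Set.Icc _ _ by constructor <;> norm_num)
  exact ⟨l, hl.1, hl.2, by linarith⟩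

/-- A form is affine in `e`, so its sign need only be checked at the two ends of the range. -/
lemma nonnegOn_sound {l e : ℝ} (hl : IsTribonacci l) {R : Range} (hR : R.Mem l e) {v : Form}
    (h : nonnegOn R v = true) : 0 ≤ eval l e v := by
  rw [nonnegOn, Bool.and_eq_true] at h
  have h1 := quadNonneg_sound hl.lower hl.upper h.1
  have h2 := quadNonneg_sound hl.lower hl.upper h.2
  push_cast at h1 h2
  rw [eval_apply]
  rcases le_total (0 : ℝ) v.2.2.2 with h0 | h0
  · linarith [mul_le_mul_of_nonneg_left hR.1 h0]
  · linarith [mul_le_mul_of_nonpos_left hR.2 h0]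

lemma eval_le_of_nonnegOn {l e : ℝ} (hl : IsTribonacci l) {R : Range} (hR : R.Mem l e) {v w : Form}
    (h : nonnegOn R (w - v) = true) : eval l e v ≤ eval l e w := by
  have := nonnegOn_sound hl hR h
  rw [map_sub] at this
  linarith

/-! ### The one-parameter family of exchanges -/

/-- The permutation of the exchange. -/
def perm : Equiv.Perm (Fin 7) where
  toFun := ![2, 5, 4, 1, 6, 0, 3]
  invFun := ![5, 3, 0, 6, 2, 1, 4]
  left_inv := by decide
  right_inv := by decide

/-- The lengths of the exchanged intervals. -/
def lengthForm : Fin 7 → Form :=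
  ![(1, 0, 0, 1), (0, 1, 0, -1), (0, 1, 0, 1), (0, 0, 1, -1), (0, -1, 1, 0), (0, 1, 0, 1),
    (1, 0, 0, -1)]

/-- The left endpoints of the exchanged intervals. -/
def leftForm : Fin 7 → Form :=
  ![(0, 0, 0, 0), (1, 0, 0, 1), (1, 1, 0, 0), (1, 2, 0, 1), (1, 2, 1, 0), (1, 1, 2, 0),
    (1, 2, 2, 1)]

/-- The translation vectors of the exchange. -/
def shiftForm : Fin 7 → Form :=
  ![(0, 1, 1, 0), (1, 2, 1, 0), (1, 0, 1, 0), (-1, -1, 0, 0), (1, 1, 0, 0), (-1, -1, -2, 0),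
    (0, -1, -1, 0)]

/-- The lengths of the intervals of the induced exchange. -/
def lengthForm' : Fin 7 → Form :=
  ![(0, 2, -1, 1), (-1, -1, 1, -1), (-1, -1, 1, 1), (1, 0, 0, -1), (2, 1, -1, 0), (-1, -1, 1, 1),
    (0, 2, -1, -1)]

/-- The left endpoints of the intervals of the induced exchange. -/
def leftForm' : Fin 7 → Form :=
  ![(0, 0, 0, 0), (0, 2, -1, 1), (-1, 1, 0, 0), (-2, 0, 1, 1), (-1, 0, 1, 0), (1, 1, 0, 0),
    (0, 0, 1, 1)]

/-- The translation vectors of the induced exchange. -/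
def shiftForm' : Fin 7 → Form :=
  ![(0, -1, 1, 0), (-1, 0, 1, 0), (1, 2, -1, 0), (1, -1, 0, 0), (-1, 1, 0, 0), (-1, -1, 0, 0),
    (0, 1, -1, 0)]

/-- The length vector with parameter `e`. -/
noncomputable def lengths (l e : ℝ) (i : Fin 7) : ℝ := eval l e (lengthForm i)

/-- The length vector of the induced exchange. -/
noncomputable def lengths' (l e : ℝ) (i : Fin 7) : ℝ := eval l e (lengthForm' i)

lemma leftEnd_eval (l e : ℝ) (v : Fin 7 → Form) (i : Fin 7) :
    leftEnd (fun j => eval l e (v j)) i = eval l e (∑ j with j < i, v j) := by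
  rw [leftEnd, map_sum]

lemma newLeftEnd_eval (σ : Equiv.Perm (Fin 7)) (l e : ℝ) (v : Fin 7 → Form) (i : Fin 7) :
    newLeftEnd σ (fun j => eval l e (v j)) i = eval l e (∑ j with σ j < σ i, v j) := by
  rw [newLeftEnd, map_sum]

lemma leftEnd_lengths (l e : ℝ) (i : Fin 7) : leftEnd (lengths l e) i = eval l e (leftForm i) :=
  (leftEnd_eval l e lengthForm i).trans (congrArg _ (by revert i; decide +kernel))

lemma leftEnd_lengths' (l e : ℝ) (i : Fin 7) :
    leftEnd (lengths' l e) i = eval l e (leftForm' i) :=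
  (leftEnd_eval l e lengthForm' i).trans (congrArg _ (by revert i; decide +kernel))

/-- No entry of `shiftForm` has an `e` component: the parameter moves the cuts but not the
translations. Hence a word whose drift vanishes does so for every parameter. -/
lemma displacement_lengths (l e : ℝ) (i : Fin 7) :
    displacement perm (lengths l e) i = eval l e (shiftForm i) := by
  rw [displacement, leftEnd_lengths,
    show newLeftEnd perm (lengths l e) i = _ from newLeftEnd_eval perm l e lengthForm i, ← map_sub]
  exact congrArg _ (by revert i; decide +kernel)

lemma displacement_lengths' (l e : ℝ) (i : Fin 7) :
    displacement perm (lengths' l e) i = eval l e (shiftForm' i) := by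
  rw [displacement, leftEnd_lengths',
    show newLeftEnd perm (lengths' l e) i = _ from newLeftEnd_eval perm l e lengthForm' i, ← map_sub]
  exact congrArg _ (by revert i; decide +kernel)

/-- The total length. -/
def totalForm : Form := (2, 2, 2, 0)

/-- The total length of the induced exchange. -/
def totalForm' : Form := (0, 2, 0, 0)

lemma total_lengths (l e : ℝ) : total (lengths l e) = eval l e totalForm := by
  exact (map_sum (eval l e) lengthForm Finset.univ).symm.trans (congrArg _ (by decide +kernel))

lemma total_lengths' (l e : ℝ) : total (lengths' l e) = eval l e totalForm' := by
  exact (map_sum (eval l e) lengthForm' Finset.univ).symm.trans (congrArg _ (by decide +kernel))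

/-- The total translation along an itinerary. -/
def driftForm (w : List (Fin 7)) : Form := (w.map shiftForm).sum

lemma drift_lengths (l e : ℝ) (w : List (Fin 7)) :
    drift perm (lengths l e) w = eval l e (driftForm w) := by
  rw [drift, driftForm, map_list_sum, List.map_map]
  congr 1
  exact List.map_congr_left fun i _ => displacement_lengths l e i

/-! ### Decidable certificates of periodicity -/

/-- Decidable certificate for `Follows`, uniform in a range of parameters. -/
def followsOn (R : Range) : Form → Form → List (Fin 7) → Bool
  | _, _, [] => true
  | x, y, i :: w => nonnegOn R (x - leftForm i) && nonnegOn R (leftForm i + lengthForm i - y) &&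
      followsOn R (x + shiftForm i) (y + shiftForm i) w

lemma followsOn_sound {l e : ℝ} (hl : IsTribonacci l) {R : Range} (hR : R.Mem l e) {x y : Form}
    {w : List (Fin 7)} (h : followsOn R x y w = true) :
    Follows perm (lengths l e) (eval l e x) (eval l e y) w := by
  induction w generalizing x y with
  | nil => trivial
  | cons i w ih =>
    simp only [followsOn, Bool.and_eq_true] at h
    refine ⟨?_, ?_, ?_⟩
    · rw [leftEnd_lengths]
      exact eval_le_of_nonnegOn hl hR h.1.1
    · rw [leftEnd_lengths, lengths, ← map_add]
      exact eval_le_of_nonnegOn hl hR h.1.2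
    · rw [displacement_lengths, ← map_add, ← map_add]
      exact ih h.2

/-- A periodic cylinder: the endpoints of an interval and its itinerary. -/
abbrev Cylinder := Form × Form × List (Fin 7)

/-- The intervals in the orbit of a cylinder. -/
def Cylinder.orbit (C : Cylinder) : List (Form × Form) :=
  (List.range C.2.2.length).map fun k =>
    (C.1 + driftForm (C.2.2.take k), C.2.1 + driftForm (C.2.2.take k))

/-- Intervals of the list `L` lead from `p` to `q` in at most `n` steps. -/
def covers (L : List (Form × Form)) : ℕ → Form → Form → Bool
  | 0, _, _ => false
  | n + 1, p, q => p == q || L.any fun I => I.1 == p && covers L n I.2 q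

lemma covers_sound {l e : ℝ} {L : List (Form × Form)} {n : ℕ} {p q : Form}
    (h : covers L n p q = true) {x : ℝ} (hx : x ∈ Set.Ico (eval l e p) (eval l e q)) :
    ∃ I ∈ L, x ∈ Set.Ico (eval l e I.1) (eval l e I.2) := by
  induction n generalizing p with
  | zero => simp [covers] at h
  | succ n ih =>
    simp only [covers, Bool.or_eq_true, beq_iff_eq, List.any_eq_true, Bool.and_eq_true] at h
    rcases h with rfl | ⟨I, hI, rfl, h⟩
    · simp at hx
    · by_cases hxI : x < eval l e I.2
      · exact ⟨I, hI, hx.1, hxI⟩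
      · exact ih h ⟨not_lt.1 hxI, hx.2⟩

/-- The cylinders in the list `Cs` certify periodicity on a range of parameters. -/
def periodicOn (R : Range) (Cs : List Cylinder) : Bool :=
  (Cs.all fun C => followsOn R C.1 C.2.1 C.2.2 && driftForm C.2.2 == 0) &&
  -- The number 100 is recursion fuel; it exceeds the number of floors in each certificate used
  -- below.
  covers (Cs.flatMap Cylinder.orbit) 100 0 totalForm

lemma lengths_nonneg {l e : ℝ} (hl : IsTribonacci l) (h1 : -1 ≤ e) (h2 : e ≤ 1) (i : Fin 7) :
    0 ≤ lengths l e i := by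
  have hR : Range.Mem l e ((-1, 0, 0), (1, 0, 0)) := by simp [Range.Mem, h1, h2]
  exact nonnegOn_sound hl hR (by revert i; decide +kernel)

/-- Each point lies on the orbit of a cylinder whose word has zero drift, so its period divides the
length of that word. -/
lemma periodicOn_sound {l e : ℝ} (hl : IsTribonacci l) (h1 : -1 ≤ e) (h2 : e ≤ 1) {R : Range}
    (hR : R.Mem l e) {Cs : List Cylinder} (h : periodicOn R Cs = true) :
    Periodic perm (lengths l e) := by
  rw [periodicOn, Bool.and_eq_true, List.all_eq_true] at h
  have ha := lengths_nonneg hl h1 h2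
  refine periodic_of_bounded_periods (Cs.map fun C => C.2.2.length).sum fun x hx => ?_
  rw [base, total_lengths, ← map_zero (eval l e)] at hx
  obtain ⟨I, hI, hxI⟩ := covers_sound h.2 hx
  obtain ⟨C, hC, hCI⟩ := List.mem_flatMap.1 hI
  obtain ⟨k, hk, rfl⟩ := List.mem_map.1 hCI
  rw [List.mem_range] at hk
  have hCs := h.1 C hC
  rw [Bool.and_eq_true, beq_iff_eq] at hCs
  have hf := followsOn_sound hl hR hCs.1
  simp only [map_add] at hxI
  set δ := eval l e (driftForm (C.2.2.take k)) with hδ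
  have hz : x - δ ∈ Set.Ico (eval l e C.1) (eval l e C.2.1) :=
    ⟨by linarith [hxI.1], by linarith [hxI.2]⟩
  have hper := hf.iterate ha hz
  rw [drift_lengths, hCs.2, map_zero, add_zero] at hper
  have hxk := (hf.take k).iterate ha hz
  rw [drift_lengths, ← hδ, sub_add_cancel, List.length_take, min_eq_left hk.le] at hxk
  refine ⟨C.2.2.length, by omega, List.single_le_sum (by simp) _ (List.mem_map_of_mem hC), ?_⟩
  rw [← hxk, ← Function.iterate_add_apply, add_comm, Function.iterate_add_apply, hper]

/-! ### The renormalisation step -/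

/-- The left endpoint of the interval of induction. -/
def offsetForm : Form := (2, 1, 1, 0)

/-- The itineraries of the intervals of the induced exchange. -/
def words : Fin 7 → List (Fin 7) :=
  ![[3, 2], [3, 3, 1], [4, 5, 1], [4, 6, 3, 2], [5, 0, 3, 1], [5, 0, 3, 2], [5, 1]]

/-- The floors that tile the exchanged intervals. -/
def tiles : Fin 7 → List (Fin 7 × ℕ) :=
  ![[(4, 1), (5, 1)], [(6, 1), (2, 2), (1, 2), (4, 3)], [(5, 3), (3, 3), (0, 1)],
    [(1, 1), (4, 2), (5, 2), (3, 2), (0, 0), (1, 0)], [(2, 0), (3, 0)],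
    [(4, 0), (5, 0), (6, 0), (2, 1)], [(3, 1)]]

/-- The endpoints of a floor. -/
def floorForm (t : Fin 7 × ℕ) : Form × Form :=
  (offsetForm + leftForm' t.1 + driftForm ((words t.1).take t.2),
    offsetForm + leftForm' t.1 + lengthForm' t.1 + driftForm ((words t.1).take t.2))

/-- Decidable version of `Consecutive`. -/
def consecutiveForms : List (Form × Form) → Form → Form → Bool
  | [], p, q => p == q
  | I :: L, p, q => I.1 == p && consecutiveForms L I.2 q

lemma consecutiveForms_sound {l e : ℝ} {L : List (Form × Form)} {p q : Form}
    (h : consecutiveForms L p q = true) :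
    Consecutive (L.map (Prod.map (eval l e) (eval l e))) (eval l e p) (eval l e q) := by
  induction L generalizing p with
  | nil =>
    rw [consecutiveForms, beq_iff_eq] at h
    exact congrArg _ h
  | cons I L ih =>
    rw [consecutiveForms, Bool.and_eq_true, beq_iff_eq] at h
    exact ⟨congrArg (eval l e) h.1, ih h.2⟩

/-- The parameters `|e| ≤ l⁻²`, for which the exchange is renormalisable. -/
def smallRange : Range := ((0, -2, 1), (0, 2, -1))

lemma floorInterval_eq (l e : ℝ) (t : Fin 7 × ℕ) :
    floorInterval perm (lengths l e) (lengths' l e) (eval l e offsetForm) words t =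
      Prod.map (eval l e) (eval l e) (floorForm t) := by
  simp only [floorInterval, floorForm, Prod.map, map_add, leftEnd_lengths', drift_lengths, lengths']

lemma smallRange_bounds {l e : ℝ} (hl : IsTribonacci l) (he : smallRange.Mem l e) :
    -1 ≤ e ∧ e ≤ 1 := by
  obtain ⟨h1, h2⟩ := he
  simp only [smallRange] at h1 h2
  push_cast at h1 h2
  have := hl.lower
  have := hl.upper
  constructor <;> nlinarith

/-- The metric conditions become identities or sign conditions between forms, so finite computations
settle the whole parameter range at once. -/
lemma renormalises {l e : ℝ} (hl : IsTribonacci l) (he : smallRange.Mem l e) :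
    Renormalises perm (lengths l e) (lengths' l e) (eval l e offsetForm) words tiles where
  nonneg := lengths_nonneg hl (smallRange_bounds hl he).1 (smallRange_bounds hl he).2
  nonneg' i := nonnegOn_sound hl he (by revert i; decide +kernel)
  ne_nil := by decide
  follows i := by
    rw [leftEnd_lengths', lengths', ← map_add, ← map_add]
    exact followsOn_sound hl he (by revert i; decide +kernel)
  drift_eq i := by
    rw [drift_lengths, displacement_lengths']
    exact congrArg _ (by revert i; decide +kernel)
  outside i k hk hkl := by
    have key : ∀ i : Fin 7, ∀ k < (words i).length, 0 < k →
        nonnegOn smallRange (offsetForm - (floorForm (i, k)).2) = true ∨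
        nonnegOn smallRange ((floorForm (i, k)).1 - (offsetForm + totalForm')) = true := by
      decide +kernel
    have h1 := congrArg Prod.fst (floorInterval_eq l e (i, k))
    have h2 := congrArg Prod.snd (floorInterval_eq l e (i, k))
    simp only [floorInterval, Prod.map] at h1 h2
    rw [h1, h2, total_lengths', ← map_add]
    exact (key i k hkl hk).imp (eval_le_of_nonnegOn hl he) (eval_le_of_nonnegOn hl he)
  consecutive j := by
    have key : ∀ j, consecutiveForms ((tiles j).map floorForm) (leftForm j)
        (leftForm j + lengthForm j) = true := by decide +kernel
    have h := consecutiveForms_sound (l := l) (e := e) (key j)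
    rw [List.map_map] at h
    rw [leftEnd_lengths, lengths, ← map_add, funext (floorInterval_eq l e)]
    exact h
  height := by decide +kernel

lemma mul_sq_eq_one {l : ℝ} (hl : IsTribonacci l) : (2 * l - l ^ 2) * l ^ 2 = 1 := by
  linear_combination (1 - l) * hl.cube

lemma scale_pos {l : ℝ} (hl : IsTribonacci l) : 0 < 2 * l - l ^ 2 := by
  nlinarith [hl.lower, hl.upper]

lemma scale_lt_one {l : ℝ} (hl : IsTribonacci l) : 2 * l - l ^ 2 < 1 := by
  nlinarith [hl.lower, hl.upper]

/-- The scale `2 l - l²` is `l⁻²`. The `e` coefficients are not contracted by the induction, so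
factoring out `l⁻²` multiplies the parameter by `l²`. -/
lemma lengths'_eq {l : ℝ} (hl : IsTribonacci l) (e : ℝ) :
    lengths' l e = (2 * l - l ^ 2) • lengths l (l ^ 2 * e) := by
  have h3 := hl.cube
  ext i
  rw [Pi.smul_apply, smul_eq_mul, lengths, lengths', eval_apply, eval_apply]
  have h1 := mul_sq_eq_one hl
  fin_cases i <;> simp [lengthForm, lengthForm']
  · linear_combination -e * h1
  · linear_combination h3 + e * h1
  · linear_combination h3 - e * h1
  · linear_combination (e - 1) * h1
  · linear_combination -h3 - h1
  · linear_combination h3 - e * h1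
  · linear_combination e * h1

/-- The certificates for periodicity away from the self-similar parameter. -/
lemma periodic_of_scale_le {l e : ℝ} (hl : IsTribonacci l) (h1 : 2 * l - l ^ 2 ≤ |e|)
    (h2 : |e| ≤ 1) : Periodic perm (lengths l e) := by
  obtain ⟨he1, he2⟩ := abs_le.1 h2
  have hmid : (0 : ℝ) < l ^ 2 - l - 1 := by nlinarith [hl.lower, hl.upper]
  -- The threshold `l² - l - 1` is `1 / l`: at `|e| = 1 / l` one of the periodic cylinders shrinks
  -- to a point and the combinatorics changes. Each sign of `e` needs its own list.
  rcases le_total (l ^ 2 - l - 1) |e| with h | h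
  · rcases abs_cases e with ⟨ha, h0⟩ | ⟨ha, h0⟩ <;> rw [ha] at h h1
    · refine periodicOn_sound hl he1 he2 (R := ((-1, -1, 1), (1, 0, 0)))
        (by constructor <;> push_cast <;> linarith)
        (Cs := [((0, 0, 0, 0), (1, 1, -1, 1), [0, 2, 5]),
          ((1, 1, -1, 1), (2, 1, -1, 0), [0, 3, 1, 5, 0, 3, 2, 3, 2, 4, 6, 3, 2, 4, 5, 1, 5]),
          ((2, 1, -1, 0), (0, 2, -1, 1), [0, 3, 2, 3, 2, 4, 5, 1, 5]),
          ((1, 2, -1, 0), (1, 0, 0, 1), [0, 3, 2, 4, 5])]) (by decide +kernel)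
    · refine periodicOn_sound hl he1 he2 (R := ((-1, 0, 0), (1, 1, -1)))
        (by constructor <;> push_cast <;> linarith)
        (Cs := [((0, 0, 0, 0), (1, 0, 0, 1), [0, 3, 1, 5, 1, 4, 6, 3, 2, 4, 6, 3, 2, 3, 3, 1, 5]),
          ((1, 0, 0, 1), (-1, 1, 0, 0), [1, 4, 6, 3, 2, 3, 3, 1, 5]),
          ((0, 1, 0, 1), (0, -1, 1, 0), [1, 4, 6, 3, 3]),
          ((0, 0, 1, 1), (1, 1, 0, 0), [1, 6, 3])]) (by decide +kernel)
  · rcases abs_cases e with ⟨ha, h0⟩ | ⟨ha, h0⟩ <;> rw [ha] at h h1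
    · refine periodicOn_sound hl he1 he2 (R := ((0, 2, -1), (-1, -1, 1)))
        (by constructor <;> push_cast <;> linarith)
        (Cs := [((0, 0, 0, 0), (3, 2, -2, 1), [0, 3, 1, 5, 0, 3, 2, 3, 2, 4, 6, 3, 2, 4, 5, 1, 5]),
          ((3, 2, -2, 1), (2, 1, -1, 0), [0, 3, 1, 5, 0, 3, 2, 3, 3, 1, 5, 0, 3, 2, 3, 2, 4, 6, 3,
            2, 4, 5, 1, 4, 6, 3, 2, 4, 5, 1, 5]),
          ((2, 1, -1, 0), (0, 2, -1, 1), [0, 3, 2, 3, 2, 4, 5, 1, 5]),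
          ((1, 2, -1, 0), (1, 0, 0, 1), [0, 3, 2, 4, 5])]) (by decide +kernel)
    · refine periodicOn_sound hl he1 he2 (R := ((1, 1, -1), (0, -2, 1)))
        (by constructor <;> push_cast <;> linarith)
        (Cs := [((0, 0, 0, 0), (-1, -1, 1, 1), [0, 3, 1, 5, 1, 4, 6, 3, 2, 4, 5, 1, 4, 6, 3, 2, 4,
            6, 3, 2, 3, 3, 1, 5, 0, 3, 2, 3, 3, 1, 5]),
          ((-1, -1, 1, 1), (2, 1, -1, 0), [0, 3, 1, 5, 1, 4, 6, 3, 2, 4, 6, 3, 2, 3, 3, 1, 5]),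
          ((1, 0, 0, 1), (-1, 1, 0, 0), [1, 4, 6, 3, 2, 3, 3, 1, 5]),
          ((0, 1, 0, 1), (0, -1, 1, 0), [1, 4, 6, 3, 3])]) (by decide +kernel)

lemma smallRange_mem {l e : ℝ} (h : |e| ≤ 2 * l - l ^ 2) : smallRange.Mem l e := by
  obtain ⟨h1, h2⟩ := abs_le.1 h
  constructor <;> simp only [smallRange] <;> push_cast <;> linarith

/-- Here `n` bounds the renormalisations needed. While `|e| ≤ l⁻²`, the new parameter `l² e` still
has absolute value at most `1`. -/
lemma periodic_of_renormalised {l e : ℝ} (hl : IsTribonacci l) (n : ℕ) (h1 : |e| ≤ 1)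
    (h2 : 2 * l - l ^ 2 ≤ |e| * (l ^ 2) ^ n) : Periodic perm (lengths l e) := by
  induction n generalizing e with
  | zero => exact periodic_of_scale_le hl (by simpa using h2) h1
  | succ n ih =>
    rcases le_total (2 * l - l ^ 2) |e| with h | h
    · exact periodic_of_scale_le hl h h1
    · have habs : |l ^ 2 * e| = l ^ 2 * |e| := by rw [abs_mul, abs_of_nonneg (sq_nonneg l)]
      have hle : |l ^ 2 * e| ≤ 1 := by
        rw [habs, ← mul_sq_eq_one hl, mul_comm]
        exact mul_le_mul_of_nonneg_right h (sq_nonneg l)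
      refine (renormalises hl (smallRange_mem h)).periodic ?_
      rw [lengths'_eq hl]
      obtain ⟨h3, h4⟩ := abs_le.1 hle
      refine periodic_smul (lengths_nonneg hl h3 h4) (scale_pos hl) (ih hle ?_)
      rw [habs]
      calc _ ≤ |e| * (l ^ 2) ^ (n + 1) := h2
        _ = _ := by ring

lemma periodic_of_ne_zero {l e : ℝ} (hl : IsTribonacci l) (h0 : e ≠ 0) (h1 : |e| ≤ 1) :
    Periodic perm (lengths l e) := by
  have he := abs_pos.2 h0
  obtain ⟨n, hn⟩ := pow_unbounded_of_one_lt ((2 * l - l ^ 2) / |e|)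
    (show 1 < l ^ 2 by nlinarith [hl.lower])
  refine periodic_of_renormalised hl n h1 ?_
  rw [div_lt_iff₀ he] at hn
  linarith

/-! ### The self-similar parameter and the segment -/

lemma lengths_pos {l e : ℝ} (hl : IsTribonacci l) (h : |e| < 1) (i : Fin 7) :
    0 < lengths l e i := by
  obtain ⟨h1, h2⟩ := abs_lt.1 h
  have := hl.lower
  have := hl.upper
  rw [lengths, eval_apply]
  fin_cases i <;> simp [lengthForm] <;> nlinarith

lemma renormalises_zero {l : ℝ} (hl : IsTribonacci l) :
    Renormalises perm (lengths l 0) ((2 * l - l ^ 2) • lengths l 0) (2 + l + l ^ 2) words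
      tiles := by
  have h := renormalises hl (smallRange_mem (e := 0) (by simpa using (scale_pos hl).le))
  rw [lengths'_eq hl, mul_zero] at h
  convert h using 1
  simp [eval_apply, offsetForm]

lemma total_zero (l : ℝ) : total (lengths l 0) = 2 + 2 * l + 2 * l ^ 2 := by
  rw [total_lengths, eval_apply]
  simp [totalForm]

lemma scale_mul_total {l : ℝ} (hl : IsTribonacci l) :
    (2 * l - l ^ 2) * total (lengths l 0) = 2 * l := by
  rw [total_zero]
  linear_combination (-2 * l) * hl.cube

lemma incidence_primitive (i j : Fin 7) :
    0 < (Matrix.of (fun i j => (incidence tiles i j : ℝ)) ^ 3) i j := by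
  -- The cube is expanded over the natural numbers, where positivity can be decided.
  have key : ∀ i j, 0 < ∑ p, (∑ q, incidence tiles i q * incidence tiles q p) *
      incidence tiles p j := by decide +kernel
  rw [pow_succ, pow_two]
  simp only [Matrix.mul_apply, Matrix.of_apply]
  exact_mod_cast key i j

lemma uniquelyErgodic {l : ℝ} (hl : IsTribonacci l) : UniquelyErgodic perm (lengths l 0) := by
  have := hl.lower
  refine (renormalises_zero hl).uniquelyErgodic (k := 3) (scale_pos hl) (scale_lt_one hl)
    (by positivity) ?_ (lengths_pos hl (by simp)) incidence_primitive ?_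
  · rw [scale_mul_total hl, total_zero]
    nlinarith
  · rw [total_zero]
    positivity

lemma selfSimilar {l : ℝ} (hl : IsTribonacci l) : SelfSimilar perm (lengths l 0) := by
  have hlow := hl.lower
  refine ⟨2 * l - l ^ 2, 2 + l + l ^ 2, scale_pos hl, scale_lt_one hl, ?_, fun x hx => ?_⟩
  · rw [scale_mul_total hl, base, total_zero]
    refine ⟨Set.Ico_subset_Ico (by positivity) (by nlinarith), fun h => ?_⟩
    have h0 : (0 : ℝ) ∈ Set.Ico 0 (2 + 2 * l + 2 * l ^ 2) := ⟨le_rfl, by positivity⟩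
    nlinarith [(h h0).1]
  · have h := (renormalises_zero hl).isFirstReturn (x := x)
    rw [total_smul] at h
    exact h hx

end Tribonacci

end IntervalExchange

open IntervalExchange.Tribonacci in
theorem mainTheorem2 :
    ∃ (d : ℕ) (σ : Equiv.Perm (Fin d)) (a₀ p q : Fin d → ℝ),
      p ≠ q ∧
      (∀ a ∈ segment ℝ p q, ∀ i, 0 < a i) ∧
      a₀ ∈ openSegment ℝ p q ∧
      IntervalExchange.UniquelyErgodic σ a₀ ∧
      IntervalExchange.SelfSimilar σ a₀ ∧
      ∀ a ∈ segment ℝ p q, a ≠ a₀ → IntervalExchange.Periodic σ a := by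
  obtain ⟨l, hl⟩ := exists_isTribonacci
  have hcomb : ∀ s t : ℝ, s + t = 1 →
      s • lengths l (-1 / 2) + t • lengths l (1 / 2) = lengths l ((t - s) / 2) := by
    intro s t hst
    ext i
    simp only [Pi.add_apply, Pi.smul_apply, smul_eq_mul, lengths, eval_apply]
    linear_combination ((lengthForm i).1 + (lengthForm i).2.1 * l +
      (lengthForm i).2.2.1 * l ^ 2) * hst
  have hseg : ∀ a ∈ segment ℝ (lengths l (-1 / 2)) (lengths l (1 / 2)),
      ∃ e, |e| < 1 ∧ a = lengths l e := by
    rintro _ ⟨s, t, hs, ht, hst, rfl⟩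
    exact ⟨(t - s) / 2, by rw [abs_lt]; constructor <;> linarith, hcomb s t hst⟩
  -- Any radius in `(0, 1)` would serve in place of `1 / 2`: lengths stay positive for `|e| < 1`.
  refine ⟨7, perm, lengths l 0, lengths l (-1 / 2), lengths l (1 / 2), ?_, ?_, ?_,
    uniquelyErgodic hl, selfSimilar hl, ?_⟩
  · intro h
    have h0 := congrFun h 0
    simp only [lengths, eval_apply, lengthForm] at h0
    norm_num at h0
  · intro a ha i
    obtain ⟨e, he, rfl⟩ := hseg a ha
    exact lengths_pos hl he i
  · refine ⟨1 / 2, 1 / 2, by norm_num, by norm_num, by norm_num, ?_⟩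
    rw [hcomb _ _ (by norm_num)]
    norm_num
  · intro a ha hne
    obtain ⟨e, he, rfl⟩ := hseg a ha
    exact periodic_of_ne_zero hl (fun h => hne (by rw [h])) he.le
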